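/- Let $X$ be a countable set, $b : X\times X\to[0,\infty)$ a symmetric function with $b(x,x)=0$ and $\sum_{y\in X} b(x,y)<\infty$ for all $x\in X$, such that the graph on $X$ whose edges are the pairs $\{x,y\}$ with $b(x,y)>0$ is connected, and let $m : X\to(0,\infty)$. Let $\ell^2(X,m)$ be the space of functions $f:X\to\mathbb C$ with $\|f\|^2=\sum_{x}|f(x)|^2m(x)<\infty$, and let $C_c(X)$ be the space of functions $X\to\mathbb C$ with finite support. A potential is a function $v : X\to\mathbb R$, with $v_\pm=(\pm v)\vee 0$; a magnetic potential is a function $\theta : X\times X\to[-\pi,\pi]$ with $\theta(x,y)=-\theta(y,x)$. For a potential $v$ and a magnetic potential $\theta$ let $Q^{(c)}_{v,\theta}$ be the symmetric sesquilinear form in $\ell^2(X,m)$ with domain $C_c(X)$, $$Q^{(c)}_{v,\theta}(f,g)=\frac12\sum_{x,y\in X} b(x,y)\bigl(f(x)-e^{i\theta(x,y)}f(y)\bigr)\overline{\bigl(g(x)-e^{i\theta(x,y)}g(y)\bigr)}+\sum_{x\in X}v(x)f(x)\overline{g(x)}\,m(x),$$ and write $Q^{(c)}_{v,\theta}(f)=Q^{(c)}_{v,\theta}(f,f)$.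 Let $\mathcal A_0$ be the set of potentials $w$ for which there is $C\ge 0$ with $$\sum_{x\in X}w_-(x)|f(x)|^2m(x)\le Q^{(c)}_{w_+,0}(f)+C\|f\|^2\qquad\text{for all } f\in C_c(X).$$ A symmetric sesquilinear form $s$ with domain $D(s)\subseteq \ell^2(X,m)$ is semi-bounded if there is $c\in\mathbb R$ with $s(f,f)\ge c\|f\|^2$ for all $f\in D(s)$; such a form is closed if $D(s)$ is complete in the norm $f\mapsto(s(f,f)+(1-c)\|f\|^2)^{1/2}$; a form is closable if it has a closed (in particular semi-bounded) extension. **Theorem.** For every $v\in\mathcal A_0$ and every magnetic potential $\theta$, the form $Q^{(c)}_{v,\theta}$ is semi-bounded and closable. **Corollary.** For every potential $v$, the form $Q^{(c)}_{v,0}$ is semi-bounded and closable if and only if $v\in\mathcal A_0$. -/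

import Mathlib

open Filter Topology ComplexConjugate

noncomputable section

/-- A connected weighted graph `(X, b, m)`: `b` is the edge weight and `m` the weight of the
vertices.  Two vertices are neighbors if `0 < b x y`. -/
structure WeightedGraph (X : Type*) where
  b : X → X → ℝ
  m : X → ℝ
  b_nonneg : ∀ x y, 0 ≤ b x y
  b_symm : ∀ x y, b x y = b y x
  b_diag : ∀ x, b x x = 0
  b_summable : ∀ x, Summable (b x)
  m_pos : ∀ x, 0 < m x
  /-- Any two vertices are joined by a path of neighbors. -/
  connected : (SimpleGraph.fromRel fun x y => 0 < b x y).Preconnected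

/-- A magnetic potential: an antisymmetric function `X × X → [-π, π]`. -/
structure MagneticPotential (X : Type*) where
  toFun : X → X → ℝ
  mem_Icc : ∀ x y, toFun x y ∈ Set.Icc (-Real.pi) Real.pi
  antisymm : ∀ x y, toFun x y = -toFun y x

instance MagneticPotential.instZero {X : Type*} : Zero (MagneticPotential X) where
  zero :=
    { toFun := fun _ _ => 0
      mem_Icc := fun _ _ => ⟨by linarith [Real.pi_pos], Real.pi_pos.le⟩
      antisymm := fun _ _ => by simp }

/-- `C_c(X)`: the complex-valued functions with finite support. -/
def finSuppFun (X : Type*) : Submodule ℂ (X → ℂ) where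
  carrier := {f | (Function.support f).Finite}
  zero_mem' := by simp
  add_mem' := fun {f g} hf hg =>
    Set.Finite.subset (Set.Finite.union hf hg) (Function.support_add f g)
  smul_mem' := fun c f hf => Set.Finite.subset hf (Function.support_const_smul_subset c f)

namespace WeightedGraph

variable {X : Type*} (G : WeightedGraph X)

/-- The space `ℓ²(X, m)`, as a space of functions (every point has positive measure). -/
def l2 : Submodule ℂ (X → ℂ) where
  carrier := {f | Summable fun x => ‖f x‖ ^ 2 * G.m x}
  zero_mem' := by simp
  add_mem' := by
    intro f g hf hg
    refine Summable.of_nonneg_of_le (fun x => by have := (G.m_pos x).le; positivity) (fun x => ?_)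
      ((hf.add hg).mul_left 2)
    have h1 : ‖f x + g x‖ ^ 2 ≤ 2 * (‖f x‖ ^ 2 + ‖g x‖ ^ 2) := by
      have := norm_add_le (f x) (g x)
      nlinarith [norm_nonneg (f x + g x), sq_nonneg (‖f x‖ - ‖g x‖)]
    calc ‖(f + g) x‖ ^ 2 * G.m x ≤ 2 * (‖f x‖ ^ 2 + ‖g x‖ ^ 2) * G.m x :=
          mul_le_mul_of_nonneg_right h1 (G.m_pos x).le
      _ = _ := by ring
  smul_mem' := by
    intro c f hf
    refine (Summable.mul_left (‖c‖ ^ 2) hf).congr fun x => ?_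
    simp [mul_pow, mul_assoc]

/-- The square `‖f‖²` of the norm of `ℓ²(X, m)`. -/
def normSq (f : X → ℂ) : ℝ := ∑' x, ‖f x‖ ^ 2 * G.m x

/-- A symmetric sesquilinear form in `ℓ²(X, m)`, defined on a linear subspace `domain`; it is
linear in the first and conjugate-linear in the second argument. -/
structure SymmForm where
  domain : Submodule ℂ (X → ℂ)
  domain_le : domain ≤ G.l2
  form : domain →ₗ[ℂ] domain →ₗ⋆[ℂ] ℂ
  symm : ∀ f g, form f g = conj (form g f)

namespace SymmForm

variable {G}

/-- The quadratic form `S(f) = S(f, f)`, which is real by symmetry. -/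
def quad (S : G.SymmForm) (f : S.domain) : ℝ := (S.form f f).re

/-- `c` is a lower bound of the form: `c ‖f‖² ≤ S(f)` on the domain. -/
def IsLowerBound (S : G.SymmForm) (c : ℝ) : Prop :=
  ∀ f : S.domain, c * G.normSq (f : X → ℂ) ≤ S.quad f

/-- Semi-bounded (from below). -/
def IsSemibounded (S : G.SymmForm) : Prop := ∃ c : ℝ, S.IsLowerBound c

/-- The square `S(f) + (1 - c) ‖f‖²` of the form norm associated with a lower bound `c`. -/
def formNormSq (S : G.SymmForm) (c : ℝ) (f : S.domain) : ℝ :=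
  S.quad f + (1 - c) * G.normSq (f : X → ℂ)

/-- A closed form: semi-bounded, and its domain is complete in the form norm. (All lower bounds
give equivalent form norms.) -/
def IsClosedForm (S : G.SymmForm) : Prop :=
  ∃ c : ℝ, S.IsLowerBound c ∧
    ∀ u : ℕ → S.domain,
      Tendsto (fun p : ℕ × ℕ => S.formNormSq c (u p.1 - u p.2)) atTop (𝓝 0) →
      ∃ f : S.domain, Tendsto (fun n => S.formNormSq c (u n - f)) atTop (𝓝 0)

/-- `T` is an extension of `S`. -/
def Extends (T S : G.SymmForm) : Prop :=
  ∃ h : S.domain ≤ T.domain, ∀ f g : S.domain,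
    T.form (Submodule.inclusion h f) (Submodule.inclusion h g) = S.form f g

/-- A form is closable if it has a closed extension. -/
def IsClosable (S : G.SymmForm) : Prop := ∃ T : G.SymmForm, T.IsClosedForm ∧ T.Extends S

end SymmForm

/-- The form `q_v(f, g) = ∑ v f ḡ m` of a potential `v`. -/
def potentialForm (v : X → ℝ) (f g : X → ℂ) : ℂ :=
  ∑' x, (v x : ℂ) * f x * conj (g x) * (G.m x : ℂ)

/-- The magnetic difference `f(x) - e^{i θ(x,y)} f(y)`. -/
def magneticDiff (θ : MagneticPotential X) (f : X → ℂ) (p : X × X) : ℂ :=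
  f p.1 - Complex.exp (Complex.I * (θ.toFun p.1 p.2 : ℂ)) * f p.2

/-- The kinetic part
`1/2 ∑ b(x,y) (f(x) - e^{i θ(x,y)} f(y)) conj (g(x) - e^{i θ(x,y)} g(y))`. -/
def energyForm (θ : MagneticPotential X) (f g : X → ℂ) : ℂ :=
  1 / 2 * ∑' p : X × X,
    (G.b p.1 p.2 : ℂ) * magneticDiff θ f p * conj (magneticDiff θ g p)

theorem finSuppFun_le_l2 : finSuppFun X ≤ G.l2 := by
  intro f hf
  refine summable_of_hasFiniteSupport (Set.Finite.subset hf fun x hx hfx => hx ?_)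
  simp [hfx]

theorem summable_potentialForm (v : X → ℝ) {f : X → ℂ} (hf : f ∈ finSuppFun X)
    (g : X → ℂ) : Summable fun x => (v x : ℂ) * f x * conj (g x) * (G.m x : ℂ) := by
  refine summable_of_hasFiniteSupport (Set.Finite.subset hf fun x hx hfx => hx ?_)
  simp [hfx]

theorem summable_b_mul_norm {f : X → ℂ} (hf : f ∈ finSuppFun X) :
    Summable fun p : X × X => G.b p.1 p.2 * ‖f p.1‖ := by
  refine (summable_prod_of_nonneg
    (fun p : X × X => mul_nonneg (G.b_nonneg p.1 p.2) (norm_nonneg (f p.1)))).mpr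
    ⟨fun x => (G.b_summable x).mul_right ‖f x‖, ?_⟩
  have hs : (Function.support fun x => ∑' y, G.b x y * ‖f x‖).Finite := by
    refine Set.Finite.subset hf fun x hx hfx => hx ?_
    simp [hfx]
  exact summable_of_hasFiniteSupport hs

theorem summable_energyForm (θ : MagneticPotential X) {f g : X → ℂ}
    (hf : f ∈ finSuppFun X) (hg : g ∈ finSuppFun X) :
    Summable fun p : X × X =>
      (G.b p.1 p.2 : ℂ) * magneticDiff θ f p * conj (magneticDiff θ g p) := by
  have hsw : Summable fun p : X × X => G.b p.1 p.2 * ‖f p.2‖ := by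
    have h := (Equiv.prodComm X X).summable_iff.mpr (G.summable_b_mul_norm hf)
    refine h.congr fun p => ?_
    simp [G.b_symm p.1 p.2]
  have hexp : ∀ (h : X → ℂ) (p : X × X), ‖magneticDiff θ h p‖ ≤ ‖h p.1‖ + ‖h p.2‖ := by
    intro h p
    refine (norm_sub_le _ _).trans (le_of_eq ?_)
    rw [norm_mul, mul_comm Complex.I, Complex.norm_exp_ofReal_mul_I, one_mul]
  obtain ⟨K, hK⟩ : ∃ K : ℝ, ∀ x, ‖g x‖ ≤ K := by
    have hfin : (Set.range fun x => ‖g x‖).Finite := by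
      refine Set.Finite.subset ((Set.Finite.image (fun x => ‖g x‖) hg).insert 0) ?_
      rintro _ ⟨x, rfl⟩
      by_cases hx : g x = 0
      · exact Or.inl (by simp [hx])
      · exact Or.inr ⟨x, hx, rfl⟩
    obtain ⟨K, hK⟩ := hfin.bddAbove
    exact ⟨K, fun x => hK ⟨x, rfl⟩⟩
  refine Summable.of_norm_bounded (((G.summable_b_mul_norm hf).add hsw).mul_right (2 * K))
    fun p => ?_
  have hb := G.b_nonneg p.1 p.2
  have hg2 : ‖magneticDiff θ g p‖ ≤ 2 * K := by
    linarith [hexp g p, hK p.1, hK p.2]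
  rw [norm_mul, norm_mul, RCLike.norm_conj, Complex.norm_real, Real.norm_of_nonneg hb, ← mul_add]
  exact mul_le_mul (mul_le_mul_of_nonneg_left (hexp f p) hb) hg2 (norm_nonneg _)
    (by positivity)

/-- The magnetic Schrödinger form `Q^{(c)}_{v,θ}` with domain `C_c(X)`. -/
def magneticForm (v : X → ℝ) (θ : MagneticPotential X) : G.SymmForm where
  domain := finSuppFun X
  domain_le := G.finSuppFun_le_l2
  form := LinearMap.mk₂'ₛₗ (RingHom.id ℂ) (starRingEnd ℂ)
    (fun f g => G.energyForm θ f g + G.potentialForm v f g)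
    (by
      intro f f' g
      have h1 := (G.summable_energyForm θ f.2 g.2).tsum_add (G.summable_energyForm θ f'.2 g.2)
      have h2 := (G.summable_potentialForm v f.2 g).tsum_add (G.summable_potentialForm v f'.2 g)
      simp only [energyForm, potentialForm]
      rw [add_add_add_comm, ← mul_add, ← h1, ← h2]
      congr 2
      · refine tsum_congr fun p => ?_
        simp only [magneticDiff, Submodule.coe_add, Pi.add_apply]; ring
      · ext x
        simp only [Submodule.coe_add, Pi.add_apply]; ring)
    (by
      intro c f g
      simp only [energyForm, potentialForm, RingHom.id_apply, smul_eq_mul, mul_add,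
        mul_left_comm c (1 / 2), ← tsum_mul_left]
      congr 2
      · ext p
        simp only [magneticDiff, Submodule.coe_smul, Pi.smul_apply, smul_eq_mul]; ring
      · ext x
        simp only [Submodule.coe_smul, Pi.smul_apply, smul_eq_mul]; ring)
    (by
      intro f g g'
      have h1 := (G.summable_energyForm θ f.2 g.2).tsum_add (G.summable_energyForm θ f.2 g'.2)
      have h2 := (G.summable_potentialForm v f.2 g).tsum_add (G.summable_potentialForm v f.2 g')
      simp only [energyForm, potentialForm]
      rw [add_add_add_comm, ← mul_add, ← h1, ← h2]
      congr 2
      · refine tsum_congr fun p => ?_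
        simp only [magneticDiff, Submodule.coe_add, Pi.add_apply, map_add, map_sub, map_mul]; ring
      · ext x
        simp only [Submodule.coe_add, Pi.add_apply, map_add]; ring)
    (by
      intro c f g
      simp only [energyForm, potentialForm, smul_eq_mul, mul_add,
        mul_left_comm (conj c) (1 / 2), ← tsum_mul_left]
      congr 2
      · ext p
        simp only [magneticDiff, Submodule.coe_smul, Pi.smul_apply, smul_eq_mul, map_sub,
          map_mul]; ring
      · ext x
        simp only [Submodule.coe_smul, Pi.smul_apply, smul_eq_mul, map_mul]; ring)
  symm := by
    intro f g
    simp only [LinearMap.mk₂'ₛₗ_apply, energyForm, potentialForm, map_add, map_mul,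
      Complex.conj_tsum]
    congr 2
    · simp [map_ofNat]
    · refine tsum_congr fun p => ?_
      simp only [Complex.conj_conj, Complex.conj_ofReal]; ring
    · ext x
      simp only [Complex.conj_conj, Complex.conj_ofReal]; ring

/-- The class `𝒜_θ`: the potentials `w` such that, for some `C ≥ 0`,
`q_{w₋}(f) ≤ Q^{(c)}_{w₊,θ}(f) + C ‖f‖²` for all `f ∈ C_c(X)`. -/
def classA (θ : MagneticPotential X) : Set (X → ℝ) :=
  {w | ∃ C : ℝ, 0 ≤ C ∧ ∀ f : finSuppFun X,
    (G.potentialForm (fun x => max (-w x) 0) f f).re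
      ≤ (G.magneticForm (fun x => max (w x) 0) θ).quad f + C * G.normSq (f : X → ℂ)}

end WeightedGraph

end

noncomputable section

/-! Splitting `v = v₊ - v₋` shows that `𝒜_θ` consists of the potentials whose form is semi-bounded,
so everything rests on one implication: semi-boundedness for `θ = 0` gives closability for every
`θ`.

The first ingredient is of Allegretto–Piepenbrink type (`exists_pos_supersolution`): a semi-bounded
form without magnetic potential has a strictly positive supersolution `u` of the operator with
potential `v + C + 1`. The second is the ground state representation (`groundState_representation`).
Substituting `f = u · (f/u)` changes the weights to `b(x,y) u(x) u(y)` and leaves a residual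
potential `W`, which is nonnegative because `u` is a supersolution. The phases `e^{iθ}` occur only
in the off-diagonal terms, where `u` cancels, so the `u` found for `θ = 0` serves every `θ`. Thus,
up to a multiple of `‖f‖²`, the form is a sum of squares `∑ |φᵢ(f)|²` of functionals continuous for
pointwise convergence. Such a sum is closed on its maximal domain (`isClosedForm_sumSqForm`), and
this is the closed extension. -/

theorem exists_norm_le_of_mem_finSuppFun {X : Type*} {f : X → ℂ} (hf : f ∈ finSuppFun X) :
    ∃ K : ℝ, ∀ x, ‖f x‖ ≤ K := by
  have hfin : (Set.range fun x => ‖f x‖).Finite := by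
    refine Set.Finite.subset ((Set.Finite.image (fun x => ‖f x‖) hf).insert 0) ?_
    rintro _ ⟨x, rfl⟩
    by_cases hx : f x = 0
    · exact Or.inl (by simp [hx])
    · exact Or.inr ⟨x, hx, rfl⟩
  obtain ⟨K, hK⟩ := hfin.bddAbove
  exact ⟨K, fun x => hK ⟨x, rfl⟩⟩

/-! ### Forms on finitely supported functions, and semi-boundedness. -/

namespace WeightedGraph

variable {X : Type*} (G : WeightedGraph X)

/-- The total edge weight at a vertex. -/
def degree (x : X) : ℝ := ∑' y, G.b x y

theorem summable_diag {f g : X → ℂ} (hf : f ∈ finSuppFun X) (hg : g ∈ finSuppFun X) :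
    Summable fun p : X × X => (G.b p.1 p.2 : ℂ) * f p.1 * conj (g p.1) := by
  obtain ⟨K, hK⟩ := exists_norm_le_of_mem_finSuppFun hg
  refine Summable.of_norm_bounded ((G.summable_b_mul_norm hf).mul_right K) fun p => ?_
  rw [norm_mul, norm_mul, RCLike.norm_conj, Complex.norm_real,
    Real.norm_of_nonneg (G.b_nonneg _ _)]
  exact mul_le_mul_of_nonneg_left (hK _) (mul_nonneg (G.b_nonneg _ _) (norm_nonneg _))

theorem summable_offDiag (θ : MagneticPotential X) {f g : X → ℂ} (hf : f ∈ finSuppFun X)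
    (hg : g ∈ finSuppFun X) :
    Summable fun p : X × X => (G.b p.1 p.2 : ℂ) *
      Complex.exp (Complex.I * (θ.toFun p.1 p.2 : ℂ)) * f p.2 * conj (g p.1) := by
  obtain ⟨K, hK⟩ := exists_norm_le_of_mem_finSuppFun hf
  refine Summable.of_norm_bounded ((G.summable_b_mul_norm hg).mul_right K) fun p => ?_
  rw [norm_mul, norm_mul, norm_mul, RCLike.norm_conj, Complex.norm_real,
    Real.norm_of_nonneg (G.b_nonneg _ _), mul_comm Complex.I, Complex.norm_exp_ofReal_mul_I,
    mul_one, mul_right_comm]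
  exact mul_le_mul_of_nonneg_left (hK _) (mul_nonneg (G.b_nonneg _ _) (norm_nonneg _))

theorem tsum_diag {f g : X → ℂ} (hf : f ∈ finSuppFun X) (hg : g ∈ finSuppFun X) :
    ∑' p : X × X, (G.b p.1 p.2 : ℂ) * f p.1 * conj (g p.1) =
      ∑' x, (G.degree x : ℂ) * f x * conj (g x) := by
  rw [(G.summable_diag hf hg).tsum_prod]
  refine tsum_congr fun x => ?_
  simp only [mul_assoc]
  rw [tsum_mul_right, degree, Complex.ofReal_tsum]

/-- The kinetic part on `C_c(X)`, split into its diagonal and off-diagonal parts. -/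
theorem energyForm_eq (θ : MagneticPotential X) {f g : X → ℂ} (hf : f ∈ finSuppFun X)
    (hg : g ∈ finSuppFun X) :
    G.energyForm θ f g = ∑' x, (G.degree x : ℂ) * f x * conj (g x) -
      ∑' p : X × X, (G.b p.1 p.2 : ℂ) *
        Complex.exp (Complex.I * (θ.toFun p.1 p.2 : ℂ)) * f p.2 * conj (g p.1) := by
  have h1 := (G.summable_diag hf hg).hasSum
  have h2 := (G.summable_offDiag θ hf hg).hasSum
  -- The product expands into two diagonal and two off-diagonal sums; swapping `x` and `y` exchanges
  -- the members of each pair, since `b` is symmetric and `θ` antisymmetric. This cancels the factor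
  -- `1/2`.
  have h := (h1.add ((Equiv.prodComm X X).hasSum_iff.mpr h1)).sub
    (h2.add ((Equiv.prodComm X X).hasSum_iff.mpr h2))
  rw [energyForm, ← G.tsum_diag hf hg]
  have key : ∑' p : X × X, (G.b p.1 p.2 : ℂ) * magneticDiff θ f p * conj (magneticDiff θ g p) = _ :=
    (tsum_congr fun p => ?_).trans h.tsum_eq
  · rw [key]; ring
  · have hc : conj (Complex.exp (Complex.I * (θ.toFun p.1 p.2 : ℂ))) =
        Complex.exp (Complex.I * (θ.toFun p.2 p.1 : ℂ)) := by
      rw [← Complex.exp_conj, θ.antisymm p.2 p.1]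
      simp
    have hm : Complex.exp (Complex.I * (θ.toFun p.1 p.2 : ℂ)) *
        Complex.exp (Complex.I * (θ.toFun p.2 p.1 : ℂ)) = 1 := by
      rw [← Complex.exp_add, θ.antisymm p.2 p.1]
      simp
    simp only [magneticDiff, map_sub, map_mul, hc, Function.comp, Equiv.prodComm_apply,
      Prod.fst_swap, Prod.snd_swap, G.b_symm p.2 p.1]
    linear_combination (G.b p.1 p.2 : ℂ) * f p.2 * conj (g p.2) * hm

theorem normSq_nonneg (f : X → ℂ) : 0 ≤ G.normSq f :=
  tsum_nonneg fun x => mul_nonneg (by positivity) (G.m_pos x).le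

theorem potentialForm_sub (v w : X → ℝ) {f : X → ℂ} (hf : f ∈ finSuppFun X) (g : X → ℂ) :
    G.potentialForm (fun x => v x - w x) f g = G.potentialForm v f g - G.potentialForm w f g := by
  rw [potentialForm, potentialForm, potentialForm,
    ← (G.summable_potentialForm v hf g).tsum_sub (G.summable_potentialForm w hf g)]
  refine tsum_congr fun x => ?_
  push_cast; ring

theorem magneticForm_quad_posPart_sub (v : X → ℝ) (θ : MagneticPotential X) (f : finSuppFun X) :
    (G.magneticForm (fun x => max (v x) 0) θ).quad f -
      (G.potentialForm (fun x => max (-v x) 0) f f).re = (G.magneticForm v θ).quad f := by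
  have h : v = fun x => max (v x) 0 - max (-v x) 0 := by
    funext x
    rcases le_total (v x) 0 with h | h <;> simp [h]
  have h' := G.potentialForm_sub (fun x => max (v x) 0) (fun x => max (-v x) 0) f.2 f
  rw [← h] at h'
  change (G.energyForm θ (f : X → ℂ) f + G.potentialForm _ f f).re - _ =
    (G.energyForm θ (f : X → ℂ) f + G.potentialForm _ f f).re
  rw [h']
  simp only [Complex.add_re, Complex.sub_re]
  ring

/-- The class `𝒜_θ` consists of the potentials with semi-bounded form. -/
theorem mem_classA_iff_isSemibounded (v : X → ℝ) (θ : MagneticPotential X) :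
    v ∈ G.classA θ ↔ (G.magneticForm v θ).IsSemibounded := by
  constructor
  · rintro ⟨C, -, h⟩
    refine ⟨-C, fun f => ?_⟩
    have h1 := h f
    have h2 := G.magneticForm_quad_posPart_sub v θ f
    linarith
  · rintro ⟨c, h⟩
    -- The maximum is needed because the class asks for a nonnegative constant.
    refine ⟨max (-c) 0, le_max_right _ _, fun f => ?_⟩
    have h1 := h f
    have h2 := G.magneticForm_quad_posPart_sub v θ f
    have h3 := mul_le_mul_of_nonneg_right (le_max_left (-c) 0) (G.normSq_nonneg (f : X → ℂ))
    linarith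

end WeightedGraph
-- Closed forms given by sums of squares of functionals.
/-- The functions on which a family of continuous functionals is square summable. -/
def squareSummable {X I : Type*} (φ : I → (X → ℂ) →L[ℂ] ℂ) : Submodule ℂ (X → ℂ) where
  carrier := {f | Memℓp (fun i => φ i f) 2}
  zero_mem' := by
    have h : (fun i => φ i 0) = 0 := by funext i; simp
    simpa only [Set.mem_ofPred_eq, h] using zero_memℓp
  add_mem' := fun {f g} hf hg => by
    have h : (fun i => φ i (f + g)) = (fun i => φ i f) + fun i => φ i g := by funext i; simp
    simpa only [Set.mem_ofPred_eq, h] using Memℓp.add hf hg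
  smul_mem' := fun c f hf => by
    have h : (fun i => φ i (c • f)) = c • fun i => φ i f := by funext i; simp
    simpa only [Set.mem_ofPred_eq, h] using Memℓp.const_smul hf c

theorem memℓp_two_iff {I : Type*} (a : I → ℂ) : Memℓp a 2 ↔ Summable fun i => ‖a i‖ ^ 2 := by
  rw [memℓp_gen_iff (by norm_num)]
  norm_num

theorem mem_squareSummable {X I : Type*} {φ : I → (X → ℂ) →L[ℂ] ℂ} {f : X → ℂ} :
    f ∈ squareSummable φ ↔ Summable fun i => ‖φ i f‖ ^ 2 := memℓp_two_iff _

/-- The values of a family of functionals, as an element of `ℓ²`. -/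
def squareSummable.toLp {X I : Type*} (φ : I → (X → ℂ) →L[ℂ] ℂ) :
    squareSummable φ →ₗ[ℂ] lp (fun _ : I => ℂ) 2 where
  toFun f := ⟨fun i => φ i f, f.2⟩
  map_add' f g := by
    apply Subtype.ext
    funext i
    exact map_add (φ i) _ _
  map_smul' c f := by
    apply Subtype.ext
    funext i
    exact map_smul (φ i) c _

theorem tendsto_coe_of_tendsto_lp {I : Type*} {a : ℕ → lp (fun _ : I => ℂ) 2}
    {l : lp (fun _ : I => ℂ) 2} (h : Tendsto a atTop (𝓝 l)) (i : I) :
    Tendsto (fun n => a n i) atTop (𝓝 (l i)) :=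
  ((continuous_apply i).comp (lp.uniformContinuous_coe (E := fun _ : I => ℂ) (p := 2)).continuous
    |>.tendsto l).comp h

namespace WeightedGraph

variable {X : Type*} (G : WeightedGraph X)

/-- The functional `f ↦ m(x)^{1/2} f(x)`. -/
def massFunctional (x : X) : (X → ℂ) →L[ℂ] ℂ :=
  ((Real.sqrt (G.m x) : ℝ) : ℂ) • ContinuousLinearMap.proj x

theorem massFunctional_apply (x : X) (f : X → ℂ) :
    G.massFunctional x f = (Real.sqrt (G.m x) : ℝ) * f x := rfl

theorem norm_massFunctional_sq (x : X) (f : X → ℂ) :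
    ‖G.massFunctional x f‖ ^ 2 = ‖f x‖ ^ 2 * G.m x := by
  rw [massFunctional_apply, norm_mul, Complex.norm_real, Real.norm_of_nonneg (Real.sqrt_nonneg _),
    mul_pow, Real.sq_sqrt (G.m_pos x).le, mul_comm]

theorem l2_eq_squareSummable : G.l2 = squareSummable G.massFunctional := by
  ext f
  rw [mem_squareSummable]
  simp only [norm_massFunctional_sq]
  rfl

variable {I : Type*} (φ : I → (X → ℂ) →L[ℂ] ℂ)

/-- The values of `φ` on `f` as an element of `ℓ²(I)`, for `f` in the maximal domain. -/
def formMap : ↥(G.l2 ⊓ squareSummable φ) →ₗ[ℂ] lp (fun _ : I => ℂ) 2 :=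
  squareSummable.toLp φ ∘ₗ Submodule.inclusion inf_le_right

/-- The isometric copy of `f ∈ ℓ²(X, m)` in `ℓ²(X)`, for `f` in the maximal domain. -/
def massMap : ↥(G.l2 ⊓ squareSummable φ) →ₗ[ℂ] lp (fun _ : X => ℂ) 2 :=
  squareSummable.toLp G.massFunctional ∘ₗ
    Submodule.inclusion (inf_le_left.trans G.l2_eq_squareSummable.le)

/-- The form `∑ φᵢ(f) conj (φᵢ(g)) - C ⟨f, g⟩` on its maximal domain. -/
def sumSqForm (C : ℝ) : G.SymmForm where
  domain := G.l2 ⊓ squareSummable φ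
  domain_le := inf_le_left
  form := LinearMap.mk₂'ₛₗ (RingHom.id ℂ) (starRingEnd ℂ)
    (fun f g => inner ℂ (G.formMap φ g) (G.formMap φ f) -
      C * inner ℂ (G.massMap φ g) (G.massMap φ f))
    (fun f f' g => by simp only [map_add, inner_add_right]; ring)
    (fun c f g => by
      simp only [map_smul, inner_smul_right, RingHom.id_apply, smul_eq_mul]; ring)
    (fun f g g' => by simp only [map_add, inner_add_left]; ring)
    (fun c f g => by simp only [map_smul, inner_smul_left, smul_eq_mul]; ring)
  symm f g := by
    simp only [LinearMap.mk₂'ₛₗ_apply, map_sub, map_mul, inner_conj_symm, Complex.conj_ofReal]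

theorem norm_massMap_sq (f : ↥(G.l2 ⊓ squareSummable φ)) :
    ‖G.massMap φ f‖ ^ 2 = G.normSq (f : X → ℂ) := by
  have h := lp.norm_rpow_eq_tsum (p := 2) (by norm_num) (G.massMap φ f)
  norm_num at h
  rw [h, normSq]
  exact tsum_congr fun x => G.norm_massFunctional_sq x f

theorem sumSqForm_quad (C : ℝ) (f : (G.sumSqForm φ C).domain) :
    (G.sumSqForm φ C).quad f = ‖G.formMap φ f‖ ^ 2 - C * G.normSq (f : X → ℂ) := by
  change (inner ℂ (G.formMap φ f) (G.formMap φ f) -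
    (C : ℂ) * inner ℂ (G.massMap φ f) (G.massMap φ f)).re = _
  rw [inner_self_eq_norm_sq_to_K, inner_self_eq_norm_sq_to_K]
  refine Eq.trans ?_ (congrArg (fun t => ‖G.formMap φ f‖ ^ 2 - C * t) (G.norm_massMap_sq φ f))
  rw [Complex.sub_re, Complex.re_ofReal_mul]
  norm_cast

theorem isLowerBound_sumSqForm (C : ℝ) : (G.sumSqForm φ C).IsLowerBound (-C) := fun f => by
  rw [sumSqForm_quad]
  have : 0 ≤ ‖G.formMap φ f‖ ^ 2 := by positivity
  linarith

theorem sumSqForm_formNormSq (C : ℝ) (f : (G.sumSqForm φ C).domain) :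
    (G.sumSqForm φ C).formNormSq (-C) f = ‖G.formMap φ f‖ ^ 2 + ‖G.massMap φ f‖ ^ 2 := by
  unfold SymmForm.formNormSq
  have h : ‖G.massMap φ f‖ ^ 2 = G.normSq (f : X → ℂ) := G.norm_massMap_sq φ f
  rw [sumSqForm_quad, h]
  ring

/-- Completeness of `ℓ²` yields limits of both images. Every vertex has positive mass, so
convergence of the mass images forces pointwise convergence of `u n`; continuity of each `φ i` then
identifies both limits as the images of the pointwise limit. -/
theorem exists_tendsto_formMap (u : ℕ → ↥(G.l2 ⊓ squareSummable φ))
    (h₁ : CauchySeq fun n => G.formMap φ (u n)) (h₂ : CauchySeq fun n => G.massMap φ (u n)) :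
    ∃ f, Tendsto (fun n => G.formMap φ (u n)) atTop (𝓝 (G.formMap φ f)) ∧
      Tendsto (fun n => G.massMap φ (u n)) atTop (𝓝 (G.massMap φ f)) := by
  obtain ⟨a, ha⟩ := cauchySeq_tendsto_of_complete h₁
  obtain ⟨c, hc⟩ := cauchySeq_tendsto_of_complete h₂
  have hs : ∀ x, ((Real.sqrt (G.m x) : ℝ) : ℂ) ≠ 0 := fun x =>
    Complex.ofReal_ne_zero.mpr (Real.sqrt_ne_zero'.mpr (G.m_pos x))
  set f : X → ℂ := fun x => c x / (Real.sqrt (G.m x) : ℝ) with hf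
  have hu : Tendsto (fun n => (u n : X → ℂ)) atTop (𝓝 f) := by
    rw [tendsto_pi_nhds]
    intro x
    refine ((tendsto_coe_of_tendsto_lp hc x).div_const _).congr fun n => ?_
    exact mul_div_cancel_left₀ _ (hs x)
  have h1 : ∀ i, φ i f = a i := fun i =>
    tendsto_nhds_unique (((φ i).continuous.tendsto f).comp hu) (tendsto_coe_of_tendsto_lp ha i)
  have h2 : ∀ x, G.massFunctional x f = c x := fun x => mul_div_cancel₀ _ (hs x)
  have hm : f ∈ G.l2 ⊓ squareSummable φ := by
    refine ⟨?_, ?_⟩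
    · rw [l2_eq_squareSummable]
      change Memℓp (fun x => G.massFunctional x f) 2
      simp only [h2]
      exact c.2
    · change Memℓp (fun i => φ i f) 2
      simp only [h1]
      exact a.2
  refine ⟨⟨f, hm⟩, ?_, ?_⟩
  · have : G.formMap φ ⟨f, hm⟩ = a := Subtype.ext (funext h1)
    rwa [this]
  · have : G.massMap φ ⟨f, hm⟩ = c := Subtype.ext (funext h2)
    rwa [this]

theorem cauchySeq_of_tendsto_norm_sub_sq {E : Type*} [NormedAddCommGroup E] {a : ℕ → E}
    (h : Tendsto (fun p : ℕ × ℕ => ‖a p.1 - a p.2‖ ^ 2) atTop (𝓝 0)) : CauchySeq a := by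
  rw [cauchySeq_iff_tendsto_dist_atTop_0]
  have h' := h.sqrt
  simp only [Real.sqrt_sq (norm_nonneg _), Real.sqrt_zero] at h'
  simpa only [dist_eq_norm] using h'

/-- Since the form norm splits as `‖A f‖² + ‖B f‖²`, being Cauchy or convergent can be tested in `E`
and `F` separately. -/
theorem SymmForm.isClosedForm_of_formNormSq_eq {E F : Type*} [NormedAddCommGroup E]
    [NormedSpace ℂ E] [NormedAddCommGroup F] [NormedSpace ℂ F] {G : WeightedGraph X}
    (S : G.SymmForm) {c : ℝ} (hc : S.IsLowerBound c) (A : S.domain →ₗ[ℂ] E) (B : S.domain →ₗ[ℂ] F)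
    (hAB : ∀ f, S.formNormSq c f = ‖A f‖ ^ 2 + ‖B f‖ ^ 2)
    (hlim : ∀ u : ℕ → S.domain, CauchySeq (fun n => A (u n)) → CauchySeq (fun n => B (u n)) →
      ∃ f, Tendsto (fun n => A (u n)) atTop (𝓝 (A f)) ∧
        Tendsto (fun n => B (u n)) atTop (𝓝 (B f))) : S.IsClosedForm := by
  refine ⟨c, hc, fun u hu => ?_⟩
  have e : ∀ f g, S.formNormSq c (f - g) = ‖A f - A g‖ ^ 2 + ‖B f - B g‖ ^ 2 := fun f g => by
    rw [hAB, map_sub, map_sub]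
  have hu' : Tendsto (fun p : ℕ × ℕ => ‖A (u p.1) - A (u p.2)‖ ^ 2 +
      ‖B (u p.1) - B (u p.2)‖ ^ 2) atTop (𝓝 0) := by
    simpa only [e] using hu
  have hA : CauchySeq fun n => A (u n) :=
    cauchySeq_of_tendsto_norm_sub_sq (squeeze_zero (fun p => sq_nonneg _)
      (fun p => le_add_of_nonneg_right (sq_nonneg _)) hu')
  have hB : CauchySeq fun n => B (u n) :=
    cauchySeq_of_tendsto_norm_sub_sq (squeeze_zero (fun p => sq_nonneg _)
      (fun p => le_add_of_nonneg_left (sq_nonneg _)) hu')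
  obtain ⟨f, h1, h2⟩ := hlim u hA hB
  refine ⟨f, ?_⟩
  simp only [e]
  have := ((h1.sub_const (A f)).norm.pow 2).add ((h2.sub_const (B f)).norm.pow 2)
  simpa using this

theorem isClosedForm_sumSqForm (C : ℝ) : (G.sumSqForm φ C).IsClosedForm :=
  SymmForm.isClosedForm_of_formNormSq_eq (G.sumSqForm φ C) (G.isLowerBound_sumSqForm φ C)
    (G.formMap φ) (G.massMap φ) (G.sumSqForm_formNormSq φ C) (G.exists_tendsto_formMap φ)

end WeightedGraph

/-! ### Positive supersolutions, by minimization on finite sets and compactness. -/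

namespace WeightedGraph

variable {X : Type*} (G : WeightedGraph X)

/-- A lower bound of `Q^{(c)}_{v,0}`, written out for real functions supported in a finite set. -/
theorem sum_sub_sum_nonneg_of_isLowerBound {v : X → ℝ} {C : ℝ}
    (h : (G.magneticForm v 0).IsLowerBound (-C)) (K : Finset X) (w : X → ℝ)
    (hw : ∀ x ∉ K, w x = 0) :
    0 ≤ ∑ x ∈ K, (G.degree x + (v x + C) * G.m x) * w x ^ 2 -
      ∑ x ∈ K, ∑ y ∈ K, G.b x y * (w x * w y) := by
  have hmem : (fun x => (w x : ℂ)) ∈ finSuppFun X :=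
    Set.Finite.subset K.finite_toSet fun x hx => by
      by_contra hxK
      exact hx (by simp [hw x hxK])
  have hn : G.normSq (fun x => (w x : ℂ)) = ∑ x ∈ K, w x ^ 2 * G.m x := by
    rw [normSq, tsum_eq_sum (s := K) fun x hx => by simp [hw x hx]]
    simp
  have hq : (G.magneticForm v 0).quad ⟨_, hmem⟩ =
      ∑ x ∈ K, (G.degree x + v x * G.m x) * w x ^ 2 -
        ∑ x ∈ K, ∑ y ∈ K, G.b x y * (w x * w y) := by
    change (G.energyForm 0 (fun x => (w x : ℂ)) (fun x => (w x : ℂ)) +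
      G.potentialForm v (fun x => (w x : ℂ)) (fun x => (w x : ℂ))).re = _
    have hz : ∀ x y, (0 : MagneticPotential X).toFun x y = 0 := fun _ _ => rfl
    rw [G.energyForm_eq 0 hmem hmem, potentialForm,
      tsum_eq_sum (s := K) fun x hx => by simp [hw x hx],
      tsum_eq_sum (s := K ×ˢ K) fun p hp => by
        rw [Finset.mem_product, not_and_or] at hp
        rcases hp with hp | hp <;> simp [hw _ hp],
      tsum_eq_sum (s := K) fun x hx => by simp [hw x hx], Finset.sum_product]
    simp only [hz, Complex.ofReal_zero, mul_zero, Complex.exp_zero, mul_one, Complex.conj_ofReal]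
    norm_cast
    rw [sub_add_eq_add_sub, ← Finset.sum_add_distrib]
    congr 1
    · exact Finset.sum_congr rfl fun x _ => by ring
    · exact Finset.sum_congr rfl fun x _ => Finset.sum_congr rfl fun y _ => by ring
  have := h ⟨_, hmem⟩
  rw [hq] at this
  change -C * G.normSq (fun x => (w x : ℂ)) ≤ _ at this
  rw [hn] at this
  have e : ∑ x ∈ K, (G.degree x + (v x + C) * G.m x) * w x ^ 2 =
      ∑ x ∈ K, (G.degree x + v x * G.m x) * w x ^ 2 + C * ∑ x ∈ K, w x ^ 2 * G.m x := by
    rw [Finset.mul_sum, ← Finset.sum_add_distrib]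
    exact Finset.sum_congr rfl fun x _ => by ring
  rw [e]
  linarith

end WeightedGraph

/-- The functional `⟨u, A u⟩ - ⟨u, b u⟩ - 2 u(o)` on functions supported in a finite set. -/
def sourceEnergy {X : Type*} (A : X → ℝ) (b : X → X → ℝ) (o : X) (K : Finset X) (u : X → ℝ) : ℝ :=
  ∑ x ∈ K, A x * u x ^ 2 - ∑ x ∈ K, ∑ y ∈ K, b x y * (u x * u y) - 2 * u o

theorem continuous_sourceEnergy {X : Type*} (A : X → ℝ) (b : X → X → ℝ) (o : X) (K : Finset X) :
    Continuous (sourceEnergy A b o K) := by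
  unfold sourceEnergy
  fun_prop

/-- The coefficient of `2 t` is the Euler–Lagrange residual at `z`; its nonnegativity is the
supersolution inequality there. -/
theorem sourceEnergy_add_single {X : Type*} [DecidableEq X] {A : X → ℝ} {b : X → X → ℝ}
    (hb : ∀ x y, b x y = b y x) (o : X) {K : Finset X} (u : X → ℝ) {z : X} (hz : z ∈ K) (t : ℝ) :
    sourceEnergy A b o K (fun x => u x + t * if x = z then 1 else 0) =
      sourceEnergy A b o K u +
        2 * t * (A z * u z - ∑ y ∈ K, b z y * u y - if z = o then 1 else 0) +
        t ^ 2 * (A z - b z z) := by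
  have h1 : ∑ x ∈ K, A x * (u x + t * if x = z then 1 else 0) ^ 2 =
      ∑ x ∈ K, A x * u x ^ 2 + A z * (2 * t * u z + t ^ 2) := by
    rw [← Finset.sum_ite_eq_of_mem' K z (fun x => A x * (2 * t * u x + t ^ 2)) hz,
      ← Finset.sum_add_distrib]
    refine Finset.sum_congr rfl fun x _ => ?_
    split_ifs <;> ring
  have h2 : ∀ x, ∑ y ∈ K, b x y * ((u x + t * if x = z then 1 else 0) *
      (u y + t * if y = z then 1 else 0)) = ∑ y ∈ K, b x y * (u x * u y) + t * (b z x * u x) +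
        if x = z then t * ∑ y ∈ K, b z y * u y + t ^ 2 * b z z else 0 := fun x => by
    have e : ∀ y ∈ K, b x y * ((u x + t * if x = z then 1 else 0) *
        (u y + t * if y = z then 1 else 0)) = b x y * (u x * u y) +
          (t * if x = z then 1 else 0) * (b x y * u y) +
          if y = z then t * b x y * (u x + t * if x = z then 1 else 0) else 0 := fun y _ => by
      split_ifs <;> ring
    rw [Finset.sum_congr rfl e, Finset.sum_add_distrib, Finset.sum_add_distrib,
      Finset.sum_ite_eq_of_mem' K z _ hz, ← Finset.mul_sum, hb x z]
    split_ifs with h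
    · subst h; ring
    · ring
  rw [sourceEnergy, sourceEnergy, h1, Finset.sum_congr rfl fun x _ => h2 x,
    Finset.sum_add_distrib, Finset.sum_add_distrib, Finset.sum_ite_eq_of_mem' K z _ hz,
    ← Finset.mul_sum]
  simp only [eq_comm (a := o) (b := z)]
  ring

/-- If `A - b` is bounded below by `m` on functions supported in a finite set, then there is a
nonnegative `u` with `(A - b) u ≥ 1_o` on this set, bounded independently of the set. -/
theorem exists_nonneg_supersolution_on {X : Type*} [DecidableEq X] {A m : X → ℝ} {b : X → X → ℝ}
    (hb : ∀ x y, b x y = b y x) (hm : ∀ x, 0 < m x) (o : X) (K : Finset X)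
    (hA : ∀ w : X → ℝ, (∀ x ∉ K, w x = 0) → ∑ x ∈ K, w x ^ 2 * m x ≤
      ∑ x ∈ K, A x * w x ^ 2 - ∑ x ∈ K, ∑ y ∈ K, b x y * (w x * w y)) :
    ∃ u ∈ Set.Icc (0 : X → ℝ) (fun x => 2 + 4 / (m o * m x)),
      ∀ x ∈ K, (if x = o then 1 else 0) + ∑ y ∈ K, b x y * u y ≤ A x * u x := by
  set M : X → ℝ := fun x => 2 + 4 / (m o * m x) with hM
  have hMpos : ∀ x, 0 ≤ M x := fun x => by
    have := hm o; have := hm x; positivity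
  -- A product of compact intervals, hence compact. Minimizing over nonnegative functions makes `u ≥
  -- 0` automatic, and only upward variations are then needed for an inequality.
  set B : Set (X → ℝ) := Set.Icc 0 fun x => if x ∈ K then M x else 0
  have h0 : (0 : X → ℝ) ∈ B := ⟨le_rfl, fun x => by
    dsimp only; split_ifs
    · exact hMpos x
    · exact le_rfl⟩
  obtain ⟨u, hu, hmin⟩ := (isCompact_Icc : IsCompact B).exists_isMinOn ⟨0, h0⟩
    (continuous_sourceEnergy A b o K).continuousOn
  have hu0 : ∀ x, 0 ≤ u x := hu.1
  have huK : ∀ x ∉ K, u x = 0 := fun x hx =>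
    le_antisymm (by simpa [hx] using hu.2 x) (hu0 x)
  -- The minimum is at most the energy `0` of the zero function; coercivity turns this into a norm
  -- bound.
  have hE : ∑ x ∈ K, u x ^ 2 * m x ≤ 2 * u o := by
    have h1 := hmin h0
    have h2 := hA u huK
    have h3 : sourceEnergy A b o K 0 = 0 := by simp [sourceEnergy]
    simp only [Set.mem_ofPred_eq, h3] at h1
    rw [sourceEnergy] at h1
    linarith
  have hterm : ∀ x ∈ K, u x ^ 2 * m x ≤ 2 * u o := fun x hx =>
    (Finset.single_le_sum (f := fun x => u x ^ 2 * m x)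
      (fun y _ => mul_nonneg (sq_nonneg _) (hm y).le) hx).trans hE
  have huo : u o * m o ≤ 2 := by
    by_cases ho : o ∈ K
    · have := hterm o ho
      rcases (hu0 o).eq_or_lt with h | h
      · rw [← h]; norm_num
      · nlinarith
    · rw [huK o ho]; norm_num
  -- The bounds `u(x)² m(x) ≤ 2 u(o)` and `u(o) m(o) ≤ 2` give `u(x)² ≤ 4 / (m(o) m(x))`, and `u + 1
  -- ≤ 2 + u²`. The minimizer thus stays at least `1` below the upper bound on `K`, which leaves
  -- room for steps `t ≤ 1`.
  have hbound : ∀ x ∈ K, u x + 1 ≤ M x := fun x hx => by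
    have h1 : u x ^ 2 ≤ 4 / (m o * m x) := by
      rw [le_div_iff₀ (mul_pos (hm o) (hm x))]
      have := mul_le_mul_of_nonneg_right (hterm x hx) (hm o).le
      nlinarith
    simp only [hM]
    nlinarith [sq_nonneg (u x - 1)]
  refine ⟨u, ⟨hu0, fun x => (hu.2 x).trans ?_⟩, fun z hz => ?_⟩
  · dsimp only; split_ifs
    · exact le_rfl
    · exact hMpos x
  · set L : ℝ := A z * u z - ∑ y ∈ K, b z y * u y - if z = o then 1 else 0 with hL
    -- First variation in the direction of the indicator of `z`, divided by `t`; `t → 0` then gives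
    -- `0 ≤ L`.
    have hvar : ∀ t : ℝ, 0 < t → t ≤ 1 → 0 ≤ 2 * L + t * (A z - b z z) := fun t ht ht1 => by
      have hmem : (fun x => u x + t * if x = z then 1 else 0) ∈ B := by
        refine ⟨fun x => ?_, fun x => ?_⟩
        · have := hu0 x
          change 0 ≤ u x + t * if x = z then 1 else 0
          split_ifs <;> linarith
        · by_cases hx : x = z
          · subst hx
            have := hbound x hz
            simp only [if_true, hz]
            linarith
          · simpa [hx] using hu.2 x
      have h := hmin hmem
      simp only [Set.mem_ofPred_eq] at h
      rw [sourceEnergy_add_single hb o u hz t, ← hL] at h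
      have : 0 ≤ t * (2 * L + t * (A z - b z z)) := by linarith
      exact nonneg_of_mul_nonneg_right this ht
    have hlim : Tendsto (fun t : ℝ => 2 * L + t * (A z - b z z)) (𝓝[>] 0) (𝓝 (2 * L)) := by
      have : Continuous fun t : ℝ => 2 * L + t * (A z - b z z) := by fun_prop
      simpa using (this.tendsto 0).mono_left nhdsWithin_le_nhds
    have : 0 ≤ 2 * L := ge_of_tendsto hlim (by
      filter_upwards [Ioc_mem_nhdsGT (zero_lt_one (α := ℝ))] with t ht using hvar t ht.1 ht.2)
    linarith

namespace WeightedGraph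

variable {X : Type*} (G : WeightedGraph X)

/-- The solution sets for finite `K` are nonempty, closed in the compact box `Set.Icc 0 M`, and
decrease as `K` grows, because enlarging `K` only adds nonnegative terms. The bound `M` does not
depend on `K`, so these sets have a common point. -/
theorem exists_nonneg_supersolution {v : X → ℝ} {C : ℝ}
    (h : (G.magneticForm v 0).IsLowerBound (-C)) [DecidableEq X] (o : X) :
    ∃ u : X → ℝ, (∀ x, 0 ≤ u x) ∧ ∀ x, ∀ K : Finset X,
      (if x = o then 1 else 0) + ∑ y ∈ K, G.b x y * u y ≤
        (G.degree x + (v x + (C + 1)) * G.m x) * u x := by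
  set M : X → ℝ := fun x => 2 + 4 / (G.m o * G.m x)
  set A : X → ℝ := fun x => G.degree x + (v x + (C + 1)) * G.m x with hA
  let Z : Finset X → Set (X → ℝ) := fun K => Set.Icc 0 M ∩
    {u | ∀ x ∈ K, (if x = o then 1 else 0) + ∑ y ∈ K, G.b x y * u y ≤ A x * u x}
  have hclosed : ∀ K, IsClosed (Z K) := fun K => by
    refine isClosed_Icc.inter ?_
    simp only [Set.ofPred_forall]
    exact isClosed_iInter fun x => isClosed_iInter fun _ =>
      isClosed_le (by fun_prop) (by fun_prop)
  have hanti : Antitone Z := fun K K' hK u hu => ⟨hu.1, fun x hx => by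
    refine le_trans ?_ (hu.2 x (hK hx))
    exact add_le_add_right (Finset.sum_le_sum_of_subset_of_nonneg hK fun y _ _ =>
      mul_nonneg (G.b_nonneg _ _) (hu.1.1 y)) _⟩
  have hne : ∀ K, (Z K).Nonempty := fun K => by
    obtain ⟨u, hu, hu'⟩ := exists_nonneg_supersolution_on (A := A) G.b_symm G.m_pos o K
      fun w hw => by
        have h1 := G.sum_sub_sum_nonneg_of_isLowerBound h K w hw
        -- The unit added to `C` supplies the coercive term `∑ w² m`.
        have e : ∑ x ∈ K, A x * w x ^ 2 =
            ∑ x ∈ K, (G.degree x + (v x + C) * G.m x) * w x ^ 2 + ∑ x ∈ K, w x ^ 2 * G.m x := by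
          rw [← Finset.sum_add_distrib]
          exact Finset.sum_congr rfl fun x _ => by simp only [hA]; ring
        linarith
    exact ⟨u, hu, hu'⟩
  obtain ⟨u, hu⟩ := IsCompact.nonempty_iInter_of_directed_nonempty_isCompact_isClosed Z
    (directed_of_isDirected_le fun _ _ hK => hanti hK) hne
    (fun K => isCompact_Icc.of_isClosed_subset (hclosed K) Set.inter_subset_left) hclosed
  rw [Set.mem_iInter] at hu
  have hu0 : ∀ x, 0 ≤ u x := (hu ∅).1.1
  refine ⟨u, hu0, fun x K => ?_⟩
  refine le_trans ?_ ((hu (insert x K)).2 x (Finset.mem_insert_self x K))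
  exact add_le_add_right (Finset.sum_le_sum_of_subset_of_nonneg (Finset.subset_insert x K)
    fun y _ _ => mul_nonneg (G.b_nonneg _ _) (hu0 y)) _

/-- A semi-bounded Schrödinger form has a strictly positive supersolution. -/
theorem exists_pos_supersolution {v : X → ℝ} {C : ℝ}
    (h : (G.magneticForm v 0).IsLowerBound (-C)) :
    ∃ u : X → ℝ, (∀ x, 0 < u x) ∧ (∀ x, Summable fun y => G.b x y * u y) ∧
      ∀ x, ∑' y, G.b x y * u y ≤ (G.degree x + (v x + (C + 1)) * G.m x) * u x := by
  classical
  rcases isEmpty_or_nonempty X with hX | ⟨⟨o⟩⟩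
  · exact ⟨fun _ => 1, hX.elim, hX.elim, hX.elim⟩
  obtain ⟨u, hu0, hu⟩ := G.exists_nonneg_supersolution h o
  have hle : ∀ x, ∀ K : Finset X, ∑ y ∈ K, G.b x y * u y ≤
      (G.degree x + (v x + (C + 1)) * G.m x) * u x := fun x K => by
    have := hu x K
    split_ifs at this <;> linarith
  -- If `u` vanished at `x`, the inequality there would give `b(x,y) u(y) ≤ 0`. Positivity therefore
  -- spreads along edges from `o`, where the source term forces it.
  have hadj : ∀ x y, 0 < G.b x y → 0 < u y → 0 < u x := fun x y hb hy => by
    refine (hu0 x).lt_of_ne fun hx => ?_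
    have := hle x {y}
    rw [← hx, mul_zero, Finset.sum_singleton] at this
    exact this.not_gt (mul_pos hb hy)
  have ho : 0 < u o := by
    refine (hu0 o).lt_of_ne fun hx => ?_
    have := hu o ∅
    rw [← hx] at this
    norm_num at this
  have hwalk : ∀ {x y : X}, (SimpleGraph.fromRel fun x y => 0 < G.b x y).Walk x y →
      0 < u y → 0 < u x := fun p hy => by
    induction p with
    | nil => exact hy
    | cons hxy _ ih =>
      rw [SimpleGraph.fromRel_adj] at hxy
      rcases hxy.2 with hb | hb
      · exact hadj _ _ hb (ih hy)
      · exact hadj _ _ (by rwa [G.b_symm]) (ih hy)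
  have hpos : ∀ x, 0 < u x := fun x => by
    obtain ⟨p⟩ := G.connected x o
    exact hwalk p ho
  have hnn : ∀ x y, 0 ≤ G.b x y * u y := fun x y => mul_nonneg (G.b_nonneg _ _) (hu0 y)
  have hs : ∀ x, Summable fun y => G.b x y * u y := fun x =>
    summable_of_sum_le (hnn x) (hle x)
  exact ⟨u, hpos, hs, fun x => (hs x).tsum_le_of_sum_le (hle x)⟩

end WeightedGraph
-- Ground state representation and closability.
theorem hasSum_sumElim {α β : Type*} {f : α → ℂ} {g : β → ℂ} (hf : Summable f) (hg : Summable g) :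
    HasSum (Sum.elim f g) (∑' x, f x + ∑' x, g x) :=
  HasSum.sum (f := Sum.elim f g) hf.hasSum hg.hasSum

theorem div_mem_finSuppFun {X : Type*} {f : X → ℂ} (hf : f ∈ finSuppFun X) (u : X → ℝ) :
    (fun x => f x / u x) ∈ finSuppFun X :=
  Set.Finite.subset hf fun x hx hfx => hx (by simp [hfx])

namespace WeightedGraph

variable {X : Type*} (G : WeightedGraph X)

/-- The graph with edge weights `b(x,y) u(x) u(y)` and vertex weights `m u²`. -/
def groundStateTransform (u : X → ℝ) (hu : ∀ x, 0 < u x)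
    (hs : ∀ x, Summable fun y => G.b x y * u y) : WeightedGraph X where
  b x y := u x * (G.b x y * u y)
  m x := u x ^ 2 * G.m x
  b_nonneg x y := mul_nonneg (hu x).le (mul_nonneg (G.b_nonneg x y) (hu y).le)
  b_symm x y := by rw [G.b_symm x y]; ring
  b_diag x := by simp [G.b_diag]
  b_summable x := (hs x).mul_left (u x)
  m_pos x := mul_pos (pow_pos (hu x) 2) (G.m_pos x)
  connected := by
    have h : (fun x y => 0 < u x * (G.b x y * u y)) = fun x y => 0 < G.b x y := by
      funext x y
      rw [mul_pos_iff_of_pos_left (hu x), mul_pos_iff_of_pos_right (hu y)]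
    rw [h]
    exact G.connected

variable {u : X → ℝ} (hu : ∀ x, 0 < u x) (hs : ∀ x, Summable fun y => G.b x y * u y)

/-- The potential left over by the ground state transform of `v + C`, including the vertex
weight: `deg + (v + C) m - (∑ b u) / u`. -/
def groundStatePotential (v : X → ℝ) (C : ℝ) (u : X → ℝ) (x : X) : ℝ :=
  G.degree x + (v x + C) * G.m x - (∑' y, G.b x y * u y) / u x

theorem summable_mul_conj {f : X → ℂ} (hf : f ∈ finSuppFun X) (a : X → ℂ) (g : X → ℂ) :
    Summable fun x => a x * f x * conj (g x) := by
  refine summable_of_hasFiniteSupport (Set.Finite.subset hf fun x hx hfx => hx ?_)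
  simp [hfx]

/-- The ground state representation of a magnetic Schrödinger form. -/
theorem groundState_representation (v : X → ℝ) (C : ℝ) (θ : MagneticPotential X) {f g : X → ℂ}
    (hf : f ∈ finSuppFun X) (hg : g ∈ finSuppFun X) :
    (G.groundStateTransform u hu hs).energyForm θ (fun x => f x / u x) (fun x => g x / u x) +
        ∑' x, (G.groundStatePotential v C u x : ℂ) * f x * conj (g x) =
      G.energyForm θ f g + G.potentialForm v f g + C * ∑' x, (G.m x : ℂ) * f x * conj (g x) := by
  have hu' : ∀ x, (u x : ℂ) ≠ 0 := fun x => Complex.ofReal_ne_zero.mpr (hu x).ne'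
  rw [G.energyForm_eq θ hf hg, energyForm_eq _ θ (div_mem_finSuppFun hf u)
    (div_mem_finSuppFun hg u), ← tsum_mul_left, potentialForm]
  -- The factors `u(x) u(y)` of the new weight cancel against the two quotients, whatever the phase.
  -- The remaining identity is diagonal, and `groundStatePotential` is the potential that makes it
  -- hold.
  have hoff : ∑' p : X × X, ((G.groundStateTransform u hu hs).b p.1 p.2 : ℂ) *
      Complex.exp (Complex.I * (θ.toFun p.1 p.2 : ℂ)) * (f p.2 / u p.2) * conj (g p.1 / u p.1) =
      ∑' p : X × X, (G.b p.1 p.2 : ℂ) *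
        Complex.exp (Complex.I * (θ.toFun p.1 p.2 : ℂ)) * f p.2 * conj (g p.1) := by
    refine tsum_congr fun p => ?_
    simp only [groundStateTransform, map_div₀, Complex.conj_ofReal]
    have := hu' p.1
    have := hu' p.2
    push_cast
    field_simp
  rw [hoff]
  have hdiag := ((summable_mul_conj (div_mem_finSuppFun hf u)
    (fun x => ((G.groundStateTransform u hu hs).degree x : ℂ)) fun x => g x / u x).hasSum.add
      (summable_mul_conj hf (fun x => (G.groundStatePotential v C u x : ℂ)) g).hasSum).tsum_eq
  have hdiag' := (((summable_mul_conj hf (fun x => (G.degree x : ℂ)) g).hasSum.add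
    (G.summable_potentialForm v hf g).hasSum).add
      ((summable_mul_conj hf (fun x => (G.m x : ℂ)) g).mul_left (C : ℂ)).hasSum).tsum_eq
  rw [sub_add_eq_add_sub, sub_add_eq_add_sub, sub_add_eq_add_sub, ← hdiag, ← hdiag']
  congr 1
  refine tsum_congr fun x => ?_
  have hd : (G.groundStateTransform u hu hs).degree x = u x * ∑' y, G.b x y * u y := tsum_mul_left
  simp only [hd, groundStatePotential, map_div₀, Complex.conj_ofReal]
  have := hu' x
  push_cast
  field_simp
  ring

/-- The functionals whose squares add up to the form transformed by `u`. -/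
def groundStateFunctional (v : X → ℝ) (C : ℝ) (θ : MagneticPotential X) :
    (X × X) ⊕ X → (X → ℂ) →L[ℂ] ℂ :=
  Sum.elim
    (fun p => ((Real.sqrt ((G.groundStateTransform u hu hs).b p.1 p.2 / 2) : ℝ) : ℂ) •
      ((u p.1 : ℂ)⁻¹ • ContinuousLinearMap.proj p.1 -
        (Complex.exp (Complex.I * (θ.toFun p.1 p.2 : ℂ)) * (u p.2 : ℂ)⁻¹) •
          ContinuousLinearMap.proj p.2))
    (fun x => ((Real.sqrt (G.groundStatePotential v C u x) : ℝ) : ℂ) • ContinuousLinearMap.proj x)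

/-- Both parts of the representation have nonnegative weights, so their square roots can be absorbed
into the functionals. -/
theorem hasSum_groundStateFunctional {v : X → ℝ} {C : ℝ} (θ : MagneticPotential X)
    (hW : ∀ x, 0 ≤ G.groundStatePotential v C u x) {f g : X → ℂ}
    (hf : f ∈ finSuppFun X) (hg : g ∈ finSuppFun X) :
    HasSum (fun i => G.groundStateFunctional hu hs v C θ i f *
        conj (G.groundStateFunctional hu hs v C θ i g))
      (G.energyForm θ f g + G.potentialForm v f g + C * ∑' x, (G.m x : ℂ) * f x * conj (g x)) := by
  rw [← G.groundState_representation hu hs v C θ hf hg, energyForm, ← tsum_mul_left]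
  have hsq : ∀ a : ℝ, 0 ≤ a → ((Real.sqrt a : ℝ) : ℂ) * (Real.sqrt a : ℝ) = (a : ℂ) :=
    fun a ha => by rw [← Complex.ofReal_mul, Real.mul_self_sqrt ha]
  convert hasSum_sumElim
    (((G.groundStateTransform u hu hs).summable_energyForm θ (div_mem_finSuppFun hf u)
      (div_mem_finSuppFun hg u)).mul_left (1 / 2))
    (summable_mul_conj hf (fun x => (G.groundStatePotential v C u x : ℂ)) g) using 1
  funext i
  rcases i with p | x
  · have h := hsq ((G.groundStateTransform u hu hs).b p.1 p.2 / 2)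
      (div_nonneg ((G.groundStateTransform u hu hs).b_nonneg _ _) zero_le_two)
    simp only [groundStateFunctional, Sum.elim_inl, smul_apply,
      sub_apply, ContinuousLinearMap.proj_apply, smul_eq_mul, magneticDiff,
      map_mul, Complex.conj_ofReal, div_eq_mul_inv] at h ⊢
    push_cast at h ⊢
    rw [mul_mul_mul_comm, h]
    simp only [map_sub, map_mul]
    ring
  · have h := hsq _ (hW x)
    simp only [groundStateFunctional, Sum.elim_inr, smul_apply,
      ContinuousLinearMap.proj_apply, smul_eq_mul, map_mul, Complex.conj_ofReal]
    rw [mul_mul_mul_comm, h, mul_assoc]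

theorem sumSqForm_apply {I : Type*} (φ : I → (X → ℂ) →L[ℂ] ℂ) (C : ℝ)
    (f g : (G.sumSqForm φ C).domain) :
    (G.sumSqForm φ C).form f g = ∑' i, φ i f * conj (φ i g) -
      C * ∑' x, (G.m x : ℂ) * (f : X → ℂ) x * conj ((g : X → ℂ) x) := by
  change inner ℂ (G.formMap φ g) (G.formMap φ f) -
    (C : ℂ) * inner ℂ (G.massMap φ g) (G.massMap φ f) = _
  rw [lp.inner_eq_tsum, lp.inner_eq_tsum]
  congr 2
  refine tsum_congr fun x => ?_
  change ((Real.sqrt (G.m x) : ℝ) * (f : X → ℂ) x) *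
    conj ((Real.sqrt (G.m x) : ℝ) * (g : X → ℂ) x) = _
  have : ((Real.sqrt (G.m x) : ℝ) : ℂ) * (Real.sqrt (G.m x) : ℝ) = (G.m x : ℂ) := by
    rw [← Complex.ofReal_mul, Real.mul_self_sqrt (G.m_pos x).le]
  rw [map_mul, Complex.conj_ofReal, mul_mul_mul_comm, this, mul_assoc]

/-- If the Schrödinger form with zero magnetic potential is semi-bounded, all magnetic forms with
the same potential have a closed extension. -/
theorem isClosable_of_isSemibounded {v : X → ℝ} (h : (G.magneticForm v 0).IsSemibounded)
    (θ : MagneticPotential X) : (G.magneticForm v θ).IsClosable := by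
  obtain ⟨c, hc⟩ := h
  obtain ⟨u, hu, hs, hsup⟩ := G.exists_pos_supersolution (C := -c) (by rwa [neg_neg])
  -- The supersolution inequality divided by `u(x) > 0`.
  have hW : ∀ x, 0 ≤ G.groundStatePotential v (-c + 1) u x := fun x =>
    sub_nonneg.mpr ((div_le_iff₀ (hu x)).mpr (hsup x))
  set φ := G.groundStateFunctional hu hs v (-c + 1) θ
  have hle : finSuppFun X ≤ G.l2 ⊓ squareSummable φ := fun f hf => by
    refine ⟨G.finSuppFun_le_l2 hf, mem_squareSummable.mpr ?_⟩
    -- Taking `g = f`, the absolute values of the summands are `‖φᵢ(f)‖²`.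
    refine (G.hasSum_groundStateFunctional hu hs θ hW hf hf).summable.norm.congr fun i => ?_
    rw [norm_mul, RCLike.norm_conj, sq]
  refine ⟨G.sumSqForm φ (-c + 1), G.isClosedForm_sumSqForm φ _, hle, fun f g => ?_⟩
  have := (G.hasSum_groundStateFunctional hu hs θ hW f.2 g.2).tsum_eq
  exact (G.sumSqForm_apply φ _ _ _).trans (sub_eq_of_eq_add this)

theorem SymmForm.IsClosable.isSemibounded {G : WeightedGraph X} {S : G.SymmForm}
    (h : S.IsClosable) : S.IsSemibounded := by
  obtain ⟨T, ⟨c, hc, -⟩, hle, hT⟩ := h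
  refine ⟨c, fun f => (hc (Submodule.inclusion hle f)).trans ?_⟩
  rw [SymmForm.quad, SymmForm.quad, hT]

end WeightedGraph

end

theorem theorem2p4 {X : Type*} [Countable X] (G : WeightedGraph X) :
    (∀ v ∈ G.classA 0, ∀ θ : MagneticPotential X,
      (G.magneticForm v θ).IsSemibounded ∧ (G.magneticForm v θ).IsClosable) ∧
    (∀ v : X → ℝ,
      ((G.magneticForm v 0).IsSemibounded ∧ (G.magneticForm v 0).IsClosable) ↔
        v ∈ G.classA 0) := by
  have h : ∀ v ∈ G.classA 0, ∀ θ : MagneticPotential X,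
      (G.magneticForm v θ).IsSemibounded ∧ (G.magneticForm v θ).IsClosable := fun v hv θ =>
    have hc := G.isClosable_of_isSemibounded ((G.mem_classA_iff_isSemibounded v 0).mp hv) θ
    ⟨hc.isSemibounded, hc⟩
  exact ⟨h, fun v => ⟨fun hv => (G.mem_classA_iff_isSemibounded v 0).mpr hv.1,
    fun hv => h v hv 0⟩⟩
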